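/- Let $E$ be a metrizable topological vector space over $\mathbb{K}=\mathbb{R}$ or $\mathbb{C}$. Write $\mathrm{w}(E)$ for the weight of $E$ (the least cardinality of a base of its topology), and for a vector subspace $F$ of $E$ write $\mathrm{codim}(F)=\dim(E/F)$ for its algebraic codimension. For $A\subseteq E$ and cardinals $\alpha,\beta$, call $A$ $\alpha$-lineable if there is a vector subspace $V$ of $E$ with $\dim V=\alpha$ and $V\smallsetminus\{0\}\subseteq A$. Call $A$ $(\alpha,\beta)$-spaceable if $A$ is $\alpha$-lineable and for every vector subspace $V\subseteq A\cup\{0\}$ of $E$ with $\dim V=\alpha$ there is a closed vector subspace $W$ of $E$ with $\dim W=\beta$ and $V\subseteq W\subseteq A\cup\{0\}$. Let $F$ be a vector subspace of $E$ with $\{0\}\neq F\neq E$ and $\mathrm{codim}(F)\geq \mathrm{w}(E)$. Then $E\smallsetminus F$ is not $(\alpha,\beta)$-spaceable for any cardinal $\alpha$ with $\mathrm{w}(E)\leq\alpha\leq\mathrm{codim}(F)$ and any cardinal $\beta$ (in particular, for no $\beta>\alpha$). -/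

import Mathlib

open Cardinal

/-- The weight of a topological space: the least cardinality of a base of its topology. -/
noncomputable def topWeight (X : Type*) [TopologicalSpace X] : Cardinal :=
  sInf {κ | ∃ B : Set (Set X), TopologicalSpace.IsTopologicalBasis B ∧ #B = κ}

section Lineability

variable (𝕜 : Type*) {E : Type*} [Field 𝕜] [AddCommGroup E] [Module 𝕜 E]

/-- The algebraic codimension of a vector subspace. -/
noncomputable def algCodim (F : Submodule 𝕜 E) : Cardinal :=
  Module.rank 𝕜 (E ⧸ F)

/-- `A ⊆ E` is `α`-lineable if `A ∪ {0}` contains an `α`-dimensional vector subspace. -/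
def IsLineable (A : Set E) (α : Cardinal) : Prop :=
  ∃ V : Submodule 𝕜 E, Module.rank 𝕜 V = α ∧ (V : Set E) \ {0} ⊆ A

/-- `A ⊆ E` is `(α, β)`-spaceable if it is `α`-lineable and every `α`-dimensional vector subspace
contained in `A ∪ {0}` lies in a closed `β`-dimensional vector subspace contained in `A ∪ {0}`.
The notion is usually considered only for `α < β` (or `α ≤ β`); no such restriction is built in. -/
def IsPairSpaceable [TopologicalSpace E] (A : Set E) (α β : Cardinal) : Prop :=
  IsLineable 𝕜 A α ∧
    ∀ V : Submodule 𝕜 E, Module.rank 𝕜 V = α → (V : Set E) ⊆ A ∪ {0} →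
      ∃ W : Submodule 𝕜 E, IsClosed (W : Set E) ∧ Module.rank 𝕜 W = β ∧
        V ≤ W ∧ (W : Set E) ⊆ A ∪ {0}

end Lineability

/-! Fix `x ≠ 0` in `F`. Lift `α` independent vectors of `E ⧸ F`, scale them so that a sequence of
them tends to `0`, and add `x`: classes mod `F` only get rescaled, so the span `V` misses `F`, yet
`x ∈ closure V`. A closed `W ⊇ V` then contains `x`. The weight serves only to make `α` infinite. -/

/-- An infinite `T₀` space has infinite weight. -/
theorem aleph0_le_topWeight (X : Type*) [TopologicalSpace X] [T0Space X] [Infinite X] :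
    ℵ₀ ≤ topWeight X := by
  refine le_csInf ⟨_, _, TopologicalSpace.isTopologicalBasis_opens, rfl⟩ ?_
  rintro κ ⟨B, hB, rfl⟩
  by_contra hlt
  have hfin : Finite B := Cardinal.lt_aleph0_iff_finite.mp (not_le.mp hlt)
  -- By `T₀`, a point is determined by the basic sets containing it.
  have hinj : Function.Injective fun x : X => {U : B | x ∈ (U : Set X)} := by
    intro x y hxy
    refine (hB.inseparable_iff.mpr fun U hU => ?_).eq
    exact Set.ext_iff.mp hxy ⟨U, hU⟩
  exact (Finite.of_injective _ hinj).not_infinite inferInstance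

/-- In a first countable topological vector space, every point `x` of a subspace `F` lies in the
closure of an `α`-dimensional subspace that meets `F` trivially, for each infinite `α` up to the
codimension of `F`. -/
theorem exists_rank_eq_disjoint_mem_closure {𝕜 : Type*} [RCLike 𝕜] {E : Type*} [AddCommGroup E]
    [Module 𝕜 E] [TopologicalSpace E] [IsTopologicalAddGroup E] [ContinuousSMul 𝕜 E]
    [FirstCountableTopology E] (F : Submodule 𝕜 E) {x : E} (hx : x ∈ F) {α : Cardinal}
    (hα : ℵ₀ ≤ α) (hα_le : α ≤ algCodim 𝕜 F) :
    ∃ V : Submodule 𝕜 E, Module.rank 𝕜 V = α ∧ Disjoint V F ∧ x ∈ closure (V : Set E) := by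
  obtain ⟨s, hs, hli⟩ := le_rank_iff_exists_linearIndependent.mp hα_le
  have : Infinite s := Cardinal.infinite_iff.mpr (hs ▸ hα)
  choose u hu using fun i : s => F.mkQ_surjective i
  obtain ⟨U, hU⟩ := (nhds (0 : E)).exists_antitone_basis
  let e := Infinite.natEmbedding s
  -- Only values on the range of `e` matter; elsewhere `k` is arbitrary.
  let k : s → ℕ := Function.invFun e
  have hc : ∀ i : s, ∃ c : 𝕜, c ≠ 0 ∧ c • u i ∈ U (k i) := fun i => by
    have ht : Filter.Tendsto (fun c : 𝕜 => c • u i) (nhdsWithin 0 {0}ᶜ) (nhds 0) := by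
      have : Continuous fun c : 𝕜 => c • u i := by fun_prop
      simpa using (this.tendsto 0).mono_left nhdsWithin_le_nhds
    exact ((eventually_mem_nhdsWithin (a := (0 : 𝕜)) (s := {0}ᶜ)).and
      (ht (hU.mem (k i)))).exists
  choose c hc0 hcU using hc
  let v : s → E := fun i => c i • u i + x
  have hv : LinearIndependent 𝕜 (F.mkQ ∘ v) := by
    have hxF : F.mkQ x = 0 := (Submodule.Quotient.mk_eq_zero F).mpr hx
    have heq : F.mkQ ∘ v = (fun i => Units.mk0 (c i) (hc0 i)) • fun i : s => (i : E ⧸ F) := by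
      ext i
      simp only [v, Function.comp_apply, map_add, map_smul, hxF, hu, add_zero]
      rfl
    rw [heq]
    exact LinearIndependent.units_smul hli _
  refine ⟨Submodule.span 𝕜 (Set.range v), ?_, ?_, ?_⟩
  · have hvE : LinearIndependent 𝕜 v := .of_comp F.mkQ hv
    rw [rank_span hvE, Cardinal.mk_range_eq v hvE.injective, hs]
  · simpa using Submodule.range_ker_disjoint hv
  · have hlim : Filter.Tendsto (fun n => v (e n)) Filter.atTop (nhds x) := by
      have h0 : Filter.Tendsto (fun n => c (e n) • u (e n)) Filter.atTop (nhds 0) :=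
        hU.tendsto fun n => by
          simpa [k, Function.leftInverse_invFun e.injective n] using hcU (e n)
      simpa [v] using h0.add_const x
    exact mem_closure_of_tendsto hlim
      (.of_forall fun n => Submodule.subset_span ⟨e n, rfl⟩)

theorem mainTheorem4 {𝕜 : Type*} [RCLike 𝕜] {E : Type*} [AddCommGroup E] [Module 𝕜 E]
    [TopologicalSpace E] [IsTopologicalAddGroup E] [ContinuousSMul 𝕜 E]
    [TopologicalSpace.MetrizableSpace E]
    (F : Submodule 𝕜 E) (hF_top : F ≠ ⊤) (hF_bot : F ≠ ⊥)
    (hcodim : topWeight E ≤ algCodim 𝕜 F)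
    (α : Cardinal) (hα_lower : topWeight E ≤ α) (hα_upper : α ≤ algCodim 𝕜 F)
    (β : Cardinal) :
    ¬ IsPairSpaceable 𝕜 ((F : Set E)ᶜ) α β := by
  rintro ⟨-, hsp⟩
  obtain ⟨x, hxF, hx0⟩ := F.ne_bot_iff.mp hF_bot
  have : Nontrivial E := ⟨x, 0, hx0⟩
  have : Infinite E := Module.Free.infinite 𝕜 E
  obtain ⟨V, hVα, hVF, hxV⟩ := exists_rank_eq_disjoint_mem_closure F hxF
    ((aleph0_le_topWeight E).trans hα_lower) hα_upper
  have hVsub : (V : Set E) ⊆ (F : Set E)ᶜ ∪ {0} := fun y hy => by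
    by_cases hyF : y ∈ F
    · exact .inr (Submodule.disjoint_def.mp hVF y hy hyF)
    · exact .inl hyF
  obtain ⟨W, hWc, -, hVW, hW⟩ := hsp V hVα hVsub
  exact (hW (closure_minimal hVW hWc hxV)).elim (fun h => h hxF) hx0
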